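/- Let $l\ge 2$ and $N=2l$. Identify $\mathbb R^2$ with $\mathbb C$, put $z=(x+iy)/2$, so that $\partial_z=\partial_x-i\partial_y$, $\partial_{\bar z}=\partial_x+i\partial_y$ and $\triangle=\partial_z\partial_{\bar z}$ is the Laplacian. Let $D\subseteq\mathbb R^2$ be open. The two dimensional elliptic $C_l^{(1)}$ Toda equation for real functions $u_1,\dots,u_l\in C^2(D)$ is $$\triangle u_1=e^{2u_1}-e^{u_2-u_1},\qquad \triangle u_j=e^{u_j-u_{j-1}}-e^{u_{j+1}-u_j}\ (2\le j\le l-1),\qquad \triangle u_l=e^{u_l-u_{l-1}}-e^{-2u_l}.$$ All matrix and vector indices are read modulo $N$, and $\{k\}\in\{0,\dots,N-1\}$ denotes the remainder of the integer $k$ modulo $N$. Let $J=(\delta_{j+1,k})_{1\le j,k\le N}$, let $V$ be the diagonal $N\times N$ matrix with $V_{jj}=e^{u_j}$ and $V_{2l+1-j,2l+1-j}=e^{-u_j}$ for $1\le j\le l$, and consider the Lax pair $$\Phi_z=(\lambda J+V_zV^{-1})\Phi,\qquad \Phi_{\bar z}=\lambda^{-1}VJ^TV^{-1}\Phi .$$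 Let $(u_1,\dots,u_l)$ be a solution of the Toda equation on $D$, and let $\mu\in\mathbb C$ with $\mu\ne 0$, $|\mu|\ne 1$. Let $\Phi(\cdot,\lambda):D\to\mathbb C^N$ be a family of column solutions of the Lax pair, for the nonzero $\lambda$ in an open set $S\ni\mu$, which is jointly $C^2$ on $S\times D$ and holomorphic in $\lambda$. Put $(h_1,\dots,h_N)^T=\Phi|_{\lambda=\mu}$ and $(h'_1,\dots,h'_N)^T=\partial_\lambda\Phi|_{\lambda=\mu}$. For integers $j$ define $$\gamma_j=\frac1{1-|\mu|^{4l}}\Bigl(\sum_{c=1}^{l}(-|\mu|^2)^{\{j+c-2\}}|h_c|^2e^{-u_c}+\sum_{c=1}^{l}(-|\mu|^2)^{\{j-c-1\}}|h_{1-c}|^2e^{u_c}\Bigr),$$ $$g_j=\frac1{4l^2}\Bigl|\sum_{c=1}^{2l}(-1)^c\bigl(\{c-j\}h_{1-c}h_c-\mu h'_{1-c}h_c\bigr)\Bigr|^2-|\mu|^2\gamma_j\gamma_{2-j}.$$ Suppose that $g_{j+1}/g_j$ is defined and positive on $D$ for $j=1,\dots,l$. Then $$\widetilde u_j=u_j+\ln\frac{g_{j+1}}{g_j}\qquad(j=1,\dots,l)$$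 is again a $C^2$ solution on $D$ of the two dimensional elliptic $C_l^{(1)}$ Toda equation. -/

import Mathlib

open scoped InnerProductSpace Matrix

noncomputable section

namespace EllipticToda

/-- The plane is identified with `ℂ` through `p = x + i y`, and the complex coordinate is
`z = (x + i y) / 2`; hence `∂_z = ∂_x - i ∂_y`. -/
def dz {E : Type*} [NormedAddCommGroup E] [NormedSpace ℂ E] (f : ℂ → E) (p : ℂ) : E :=
  fderiv ℝ f p 1 - Complex.I • fderiv ℝ f p Complex.I

/-- `∂_{z̄} = ∂_x + i ∂_y` for `z = (x + i y) / 2`, so that `∂_z ∂_{z̄} = ∂_x² + ∂_y²`. -/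
def dzbar {E : Type*} [NormedAddCommGroup E] [NormedSpace ℂ E] (f : ℂ → E) (p : ℂ) : E :=
  fderiv ℝ f p 1 + Complex.I • fderiv ℝ f p Complex.I

/-- `(u_1, …, u_l)` is a (classical) solution on `D` of the two dimensional elliptic `C_l^{(1)}`
Toda equation. Only the values `u j` with `1 ≤ j ≤ l` occur (for `2 ≤ l`). -/
def IsTodaSolution (l : ℕ) (D : Set ℂ) (u : ℕ → ℂ → ℝ) : Prop :=
  (∀ j, 1 ≤ j → j ≤ l → ContDiffOn ℝ 2 (u j) D) ∧
  ∀ p ∈ D,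
    (Laplacian.laplacian (u 1) p = Real.exp (2 * u 1 p) - Real.exp (u 2 p - u 1 p)) ∧
    (∀ j, 2 ≤ j → j < l →
      Laplacian.laplacian (u j) p
        = Real.exp (u j p - u (j - 1) p) - Real.exp (u (j + 1) p - u j p)) ∧
    (Laplacian.laplacian (u l) p = Real.exp (u l p - u (l - 1) p) - Real.exp (-2 * u l p))

/-- The diagonal of `V`: `V_{jj} = e^{u_j}` and `V_{2l+1-j,2l+1-j} = e^{-u_j}` for `1 ≤ j ≤ l`.
Indices are taken modulo `N = 2 l`; the class of `2 l` is `0`. -/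
def vdiag (l : ℕ) (u : ℕ → ℂ → ℝ) (p : ℂ) (j : ZMod (2 * l)) : ℂ :=
  if 1 ≤ j.val ∧ j.val ≤ l then (Real.exp (u j.val p) : ℂ)
  else (Real.exp (-u (1 - j).val p) : ℂ)

/-- The matrix `V`. -/
def matV (l : ℕ) (u : ℕ → ℂ → ℝ) (p : ℂ) : Matrix (ZMod (2 * l)) (ZMod (2 * l)) ℂ :=
  Matrix.diagonal (vdiag l u p)

/-- The matrix `J`, `J_{jk} = δ_{j+1,k}` (indices modulo `2 l`). -/
def matJ (l : ℕ) : Matrix (ZMod (2 * l)) (ZMod (2 * l)) ℂ :=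
  Matrix.of fun j k => if j + 1 = k then 1 else 0

/-- `P = V_z V⁻¹`. -/
def matP (l : ℕ) [NeZero l] (u : ℕ → ℂ → ℝ) (p : ℂ) :
    Matrix (ZMod (2 * l)) (ZMod (2 * l)) ℂ :=
  Matrix.diagonal (dz (vdiag l u) p) * (matV l u p)⁻¹

/-- `Q = V Jᵀ V⁻¹`. -/
def matQ (l : ℕ) [NeZero l] (u : ℕ → ℂ → ℝ) (p : ℂ) :
    Matrix (ZMod (2 * l)) (ZMod (2 * l)) ℂ :=
  matV l u p * (matJ l)ᵀ * (matV l u p)⁻¹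

/-- `φ` is a column solution on `D` of the Lax pair
`Φ_z = (lam J + P) Φ`, `Φ_{z̄} = lam⁻¹ Q Φ` with spectral parameter `lam`. -/
def IsLaxSolution (l : ℕ) [NeZero l] (D : Set ℂ) (u : ℕ → ℂ → ℝ) (lam : ℂ)
    (φ : ℂ → ZMod (2 * l) → ℂ) : Prop :=
  DifferentiableOn ℝ φ D ∧
  ∀ p ∈ D,
    dz φ p = (lam • matJ l + matP l u p) *ᵥ φ p ∧
    dzbar φ p = (lam⁻¹ • matQ l u p) *ᵥ φ p

/-- `{k}`: the remainder of the integer `k` modulo `N = 2 l`, in `{0, …, 2 l - 1}`. -/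
def rem (l : ℕ) (k : ℤ) : ℕ := (k % (2 * l : ℤ)).toNat

/-- Component `h_k` of a column, with `k` any integer, read modulo `2 l`. -/
def comp {l : ℕ} (h : ZMod (2 * l) → ℂ) (k : ℤ) : ℂ := h (k : ZMod (2 * l))

/-- The function `γ_j` at the point `p`, where `h` is the value at `p` of the Lax solution. -/
def gam (l : ℕ) (mu : ℂ) (u : ℕ → ℂ → ℝ) (h : ZMod (2 * l) → ℂ) (p : ℂ) (j : ℤ) : ℝ :=
  1 / (1 - ‖mu‖ ^ (4 * l)) *
    (∑ c ∈ Finset.Icc 1 l,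
        (-‖mu‖ ^ 2) ^ rem l (j + c - 2) * ‖comp h c‖ ^ 2 * Real.exp (-u c p)
      + ∑ c ∈ Finset.Icc 1 l,
        (-‖mu‖ ^ 2) ^ rem l (j - c - 1) * ‖comp h (1 - c)‖ ^ 2 * Real.exp (u c p))

/-- The function `g_j` at the point `p`, where `h` and `h'` are the values at `p` of the Lax
solution at `λ = μ` and of its `λ`-derivative. -/
def gfun (l : ℕ) (mu : ℂ) (u : ℕ → ℂ → ℝ) (h h' : ZMod (2 * l) → ℂ) (p : ℂ) (j : ℤ) : ℝ :=
  1 / (4 * (l : ℝ) ^ 2) *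
    ‖∑ c ∈ Finset.Icc 1 (2 * l),
        (-1 : ℂ) ^ c *
          ((rem l (c - j) : ℂ) * comp h (1 - c) * comp h c
            - mu * comp h' (1 - c) * comp h c)‖ ^ 2
    - ‖mu‖ ^ 2 * gam l mu u h p j * gam l mu u h p (2 - j)

/-- `g_j` for a family `Φ lam p` of Lax solutions: `h = Φ mu` and `h' = ∂Φ/∂lam` at `lam = mu`. -/
def gOf (l : ℕ) [NeZero l] (mu : ℂ) (u : ℕ → ℂ → ℝ) (Φ : ℂ → ℂ → ZMod (2 * l) → ℂ) (j : ℤ)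
    (p : ℂ) : ℝ :=
  gfun l mu u (Φ mu p) (deriv (fun lam => Φ lam p) mu) p j

end EllipticToda

end

/-! Each `g_j` is a tau function τ_j = |B_j|² − |μ|² G_j G_{2−j}, where B = `skewPot` pairs Φ with
itself and G = `hermPot` pairs Φ with its conjugate. Both are sums over the cyclic index whose
derivatives collapse: the Lax pair turns the derivative of a summand into a difference of
neighbours, and summation by parts leaves one product of components. For G the weights are powers of
q = −|μ|², and |μ| ≠ 1 makes the normalising factor 1 − q^{2l} nonzero. For B the ratio is 1 and
that factor would vanish; the weights are linear instead, and the ∂_λΦ term cancels the total sum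
left over.

Moving the index of B or G by one also costs a single product. Hence near index k everything is
rational in B_k, G_k, G_{2−k} and a few components, and `tau_bilinear` becomes pure algebra. Divided
by τ_k² it says Δ log|τ_k| = (v_k/v_{k−1}) (1 − τ_{k+1}τ_{k−1}/τ_k²). As e^{ũ_j} = e^{u_j}
τ_{j+1}/τ_j, the subtracted term is the exponential e^{ũ_k − ũ_{k−1}} of the new solution. Adding Δ
log|τ_{j+1}| − Δ log|τ_j| to the equation for u_j therefore replaces u by ũ in each exponential. At
the two ends this needs τ_0 = τ_2 and τ_{l+2} = τ_l, both cases of `tau_reflect`. -/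

open scoped InnerProductSpace Matrix

noncomputable section

namespace EllipticToda

open scoped ComplexConjugate Topology

/-! ### Wirtinger derivatives -/

/-- The real-linear map with Wirtinger coefficients `a`, `b` (in the coordinate `z = p / 2`). -/
def wirt (a b : ℂ) : ℂ →L[ℝ] ℂ :=
  (a / 2) • ContinuousLinearMap.id ℝ ℂ + (b / 2) • (Complex.conjCLE : ℂ →L[ℝ] ℂ)

lemma wirt_apply (a b e : ℂ) : wirt a b e = (a * e + b * conj e) / 2 := by
  simp [wirt]; ring

/-- `f` is real differentiable at `p` with `∂_z f = a` and `∂_{z̄} f = b`. -/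
def HasWirt (f : ℂ → ℂ) (p a b : ℂ) : Prop := HasFDerivAt f (wirt a b) p

namespace HasWirt

variable {f g : ℂ → ℂ} {p a b a' b' : ℂ}

lemma dz (h : HasWirt f p a b) : dz f p = a := by
  rw [EllipticToda.dz, HasFDerivAt.fderiv h]
  simp only [wirt_apply, smul_eq_mul, Complex.conj_I, map_one]
  linear_combination (-a / 2 + b / 2) * Complex.I_sq

lemma dzbar (h : HasWirt f p a b) : dzbar f p = b := by
  rw [EllipticToda.dzbar, HasFDerivAt.fderiv h]
  simp only [wirt_apply, smul_eq_mul, Complex.conj_I, map_one]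
  linear_combination (a / 2 - b / 2) * Complex.I_sq

lemma of_differentiableAt (h : DifferentiableAt ℝ f p) :
    HasWirt f p (EllipticToda.dz f p) (EllipticToda.dzbar f p) := by
  have h1 := h.hasFDerivAt
  refine h1.congr_fderiv ?_
  ext e
  have he : fderiv ℝ f p e = e.re * fderiv ℝ f p 1 + e.im * fderiv ℝ f p Complex.I := by
    conv_lhs => rw [show e = e.re • (1 : ℂ) + e.im • Complex.I by
      simp [Complex.re_add_im]]
    rw [map_add, map_smul, map_smul]; simp
  rw [he, wirt_apply, EllipticToda.dz, EllipticToda.dzbar]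
  conv_rhs => rw [← Complex.re_add_im e]
  simp only [smul_eq_mul, map_add, map_mul, Complex.conj_ofReal, Complex.conj_I]
  linear_combination (e.im * fderiv ℝ f p Complex.I) * Complex.I_sq

lemma congr_val (h : HasWirt f p a b) (ha : a = a') (hb : b = b') : HasWirt f p a' b' := by
  subst ha hb; exact h

lemma congr_fun (h : HasWirt f p a b) (hg : g =ᶠ[𝓝 p] f) : HasWirt g p a b :=
  HasFDerivAt.congr_of_eventuallyEq h hg

lemma const (c : ℂ) : HasWirt (fun _ => c) p 0 0 :=
  (hasFDerivAt_const c p).congr_fderiv (by ext; simp [wirt])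

lemma add (hf : HasWirt f p a b) (hg : HasWirt g p a' b') :
    HasWirt (fun x => f x + g x) p (a + a') (b + b') :=
  (HasFDerivAt.add hf hg).congr_fderiv (by ext; simp [wirt_apply]; ring)

lemma sub (hf : HasWirt f p a b) (hg : HasWirt g p a' b') :
    HasWirt (fun x => f x - g x) p (a - a') (b - b') :=
  (HasFDerivAt.sub hf hg).congr_fderiv (by ext; simp [wirt_apply]; ring)

lemma mul (hf : HasWirt f p a b) (hg : HasWirt g p a' b') :
    HasWirt (fun x => f x * g x) p (a * g p + f p * a') (b * g p + f p * b') :=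
  (HasFDerivAt.mul hf hg).congr_fderiv (by ext; simp [wirt_apply]; ring)

lemma const_mul (c : ℂ) (hf : HasWirt f p a b) : HasWirt (fun x => c * f x) p (c * a) (c * b) :=
  ((const c).mul hf).congr_val (by ring) (by ring)

lemma sum {ι : Type*} (s : Finset ι) {f : ι → ℂ → ℂ} {a b : ι → ℂ}
    (h : ∀ i, HasWirt (f i) p (a i) (b i)) :
    HasWirt (fun x => ∑ i ∈ s, f i x) p (∑ i ∈ s, a i) (∑ i ∈ s, b i) := by
  classical
  induction s using Finset.induction_on with
  | empty => simpa using const (p := p) 0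
  | insert i s hi ih => simpa [Finset.sum_insert hi] using (h i).add ih

lemma star (hf : HasWirt f p a b) : HasWirt (fun x => conj (f x)) p (conj b) (conj a) :=
  ((Complex.conjCLE : ℂ →L[ℝ] ℂ).hasFDerivAt.comp p hf).congr_fderiv
    (by ext; simp [wirt_apply, Complex.conj_ofNat]; ring)

lemma inv (hf : HasWirt f p a b) (h0 : f p ≠ 0) :
    HasWirt (fun x => (f x)⁻¹) p (-a / f p ^ 2) (-b / f p ^ 2) := by
  have h := ((hasDerivAt_inv h0).hasFDerivAt.restrictScalars ℝ).comp p hf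
  refine h.congr_fderiv ?_
  ext e
  simp [wirt_apply]
  ring

lemma div (hf : HasWirt f p a b) (hg : HasWirt g p a' b') (h0 : g p ≠ 0) :
    HasWirt (fun x => f x / g x) p ((a * g p - f p * a') / g p ^ 2)
      ((b * g p - f p * b') / g p ^ 2) := by
  simp only [div_eq_mul_inv (f _)]
  exact (hf.mul (hg.inv h0)).congr_val (by field_simp; ring) (by field_simp; ring)

end HasWirt

lemma contDiff_wirt : ContDiff ℝ 2 (fun x : ℂ × ℂ => wirt x.1 x.2) := by
  unfold wirt
  exact ((contDiff_fst.div_const 2).smul contDiff_const).add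
    ((contDiff_snd.div_const 2).smul contDiff_const)

lemma contDiffOn_two_of_hasWirt {D : Set ℂ} (hD : IsOpen D) {f a b : ℂ → ℂ}
    (h : ∀ p ∈ D, HasWirt f p (a p) (b p)) (ha : ContDiffOn ℝ 1 a D) (hb : ContDiffOn ℝ 1 b D) :
    ContDiffOn ℝ 2 f D := by
  rw [show (2 : WithTop ℕ∞) = 1 + 1 by norm_num, contDiffOn_succ_iff_fderiv_of_isOpen hD]
  refine ⟨fun p hp => (HasFDerivAt.differentiableAt (h p hp)).differentiableWithinAt,
    by simp, ?_⟩
  have h1 : ContDiffOn ℝ 1 (fun p => wirt (a p) (b p)) D :=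
    (contDiff_wirt.of_le (by norm_num)).comp_contDiffOn (ha.prodMk hb)
  exact h1.congr fun p hp => HasFDerivAt.fderiv (h p hp)

/-- With no factor 1/2 in `dz` and `dzbar`, their composite is exactly Δ once the mixed terms
±i∂_x∂_y cancel by symmetry of the second derivative. -/
lemma laplacian_eq_of_hasWirt {f a : ℂ → ℂ} {b : ℂ → ℂ} {p c d : ℂ} (hf : ContDiffAt ℝ 2 f p)
    (h : ∀ᶠ x in 𝓝 p, HasWirt f x (a x) (b x)) (ha : HasWirt a p c d) :
    Laplacian.laplacian f p = d := by
  have hsymm : IsSymmSndFDerivAt ℝ f p :=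
    hf.isSymmSndFDerivAt (by simp [minSmoothness_of_isRCLikeNormedField])
  have hd : HasFDerivAt (fderiv ℝ f) (fderiv ℝ (fderiv ℝ f) p) p := by
    have := (hf.fderiv_right (m := 1) (by norm_num)).differentiableAt (by norm_num)
    exact this.hasFDerivAt
  set T := fderiv ℝ (fderiv ℝ f) p with hT
  -- Near p the function `a` is f_x − i f_y, so uniqueness of derivatives expresses c and d through
  -- T.
  have hda : HasFDerivAt a _ p :=
    ((hd.clm_apply (hasFDerivAt_const (1 : ℂ) p)).sub
      ((hd.clm_apply (hasFDerivAt_const Complex.I p)).const_smul Complex.I)).congr_of_eventuallyEq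
    (by
      filter_upwards [h] with x hx
      exact hx.dz.symm)
  have hu := HasFDerivAt.unique ha hda
  have e1 := congrArg (fun L : ℂ →L[ℝ] ℂ => L 1 + Complex.I * L Complex.I) hu
  simp only [wirt_apply] at e1
  simp at e1
  rw [InnerProductSpace.laplacian_eq_iteratedFDeriv_complexPlane]
  simp only [iteratedFDeriv_two_apply, ← hT]
  have hs := hsymm 1 Complex.I
  rw [← hT] at hs
  simp
  linear_combination -e1 - (d / 2 - c / 2 - T Complex.I Complex.I) * Complex.I_sq +
    Complex.I * hs

/-- Differentiates the Lax pair in λ: symmetry of the second derivative exchanges the parameter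
direction (1, 0) with the plane direction (0, e). -/
lemma hasWirt_fderiv_fst {F : ℂ × ℂ → ℂ} {mu p α' β' : ℂ} {α β : ℂ → ℂ}
    (hF : ContDiffAt ℝ 2 F (mu, p))
    (h : ∀ᶠ lam in 𝓝 mu, HasWirt (fun x => F (lam, x)) p (α lam) (β lam))
    (hα : HasDerivAt α α' mu) (hβ : HasDerivAt β β' mu) :
    HasWirt (fun x => fderiv ℝ F (mu, x) (1, 0)) p α' β' := by
  have hsymm : IsSymmSndFDerivAt ℝ F (mu, p) :=
    hF.isSymmSndFDerivAt (by simp [minSmoothness_of_isRCLikeNormedField])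
  have hd : HasFDerivAt (fderiv ℝ F) (fderiv ℝ (fderiv ℝ F) (mu, p)) (mu, p) :=
    ((hF.fderiv_right (m := 1) (by norm_num)).differentiableAt (by norm_num)).hasFDerivAt
  have hdiff : ∀ᶠ lam in 𝓝 mu, DifferentiableAt ℝ F (lam, p) := by
    have h1 : ∀ᶠ q in 𝓝 (mu, p), DifferentiableAt ℝ F q := by
      have := hF.eventually (by simp)
      filter_upwards [this] with q hq using hq.differentiableAt (by norm_num)
    exact (Continuous.prodMk_left p).continuousAt.eventually h1
  set T := fderiv ℝ (fderiv ℝ F) (mu, p) with hT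
  have h1 : HasFDerivAt (fun x => fderiv ℝ F (mu, x) (1, 0)) _ p :=
    (hd.comp p (hasFDerivAt_prodMk_right mu p)).clm_apply (hasFDerivAt_const ((1, 0) : ℂ × ℂ) p)
  refine h1.congr_fderiv ?_
  ext e
  have h2 : HasFDerivAt (fun lam => fderiv ℝ F (lam, p) (0, e)) _ mu :=
    (hd.comp mu (hasFDerivAt_prodMk_left mu p)).clm_apply
      (hasFDerivAt_const ((0, e) : ℂ × ℂ) mu)
  have h3 : HasDerivAt (fun lam => (α lam * e + β lam * conj e) / 2)
      ((α' * e + β' * conj e) / 2) mu :=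
    ((hα.mul_const e).add (hβ.mul_const (conj e))).div_const 2
  have h4 : (fun lam => fderiv ℝ F (lam, p) (0, e)) =ᶠ[𝓝 mu]
      fun lam => (α lam * e + β lam * conj e) / 2 := by
    filter_upwards [h, hdiff] with lam hl hl'
    have := hl'.hasFDerivAt.comp p (hasFDerivAt_prodMk_right lam p)
    have := congrArg (fun L : ℂ →L[ℝ] ℂ => L e) (HasFDerivAt.unique this hl)
    simpa [wirt_apply] using this
  have h5 := (h3.hasFDerivAt.restrictScalars ℝ).congr_of_eventuallyEq h4
  have h6 := congrArg (fun L : ℂ →L[ℝ] ℂ => L 1) (HasFDerivAt.unique h2 h5)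
  have hs := hsymm (0, e) (1, 0)
  simp at h6
  simp [wirt_apply]
  rw [← hT] at hs
  rw [hs, h6]

/-! ### Sums over residues modulo `2 l` -/

section Residues

variable {l : ℕ} [NeZero l]

lemma rem_eq_val (k : ℤ) : rem l k = (k : ZMod (2 * l)).val := by
  have h := ZMod.val_intCast (n := 2 * l) k
  rw [rem]
  push_cast at h
  omega

lemma val_eq_val_sub_one_add_one {x : ZMod (2 * l)} (hx : x ≠ 0) :
    x.val = (x - 1).val + 1 := by
  have hl := NeZero.pos l
  have h1 : (1 : ZMod (2 * l)).val = 1 := by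
    have : Fact (1 < 2 * l) := ⟨by omega⟩
    exact ZMod.val_one _
  have h0 : x.val ≠ 0 := by simpa using hx
  rw [ZMod.val_sub (by omega), h1]
  omega

lemma val_neg_one_eq : ((0 : ZMod (2 * l)) - 1).val + 1 = 2 * l := by
  obtain ⟨n, hn⟩ : ∃ n, 2 * l = n + 1 := ⟨2 * l - 1, by have := NeZero.pos l; omega⟩
  have h := ZMod.val_neg_one n
  have key : ∀ m, m = n + 1 → ((0 : ZMod m) - 1).val + 1 = m := by
    rintro m rfl
    rw [zero_sub, h]
  exact key _ hn

lemma sum_zmod_eq_range (f : ZMod (2 * l) → ℂ) :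
    ∑ x, f x = ∑ i ∈ Finset.range (2 * l), f (i : ZMod (2 * l)) := by
  refine Finset.sum_bij' (fun x _ => x.val) (fun i _ => (i : ZMod (2 * l))) ?_ ?_ ?_ ?_ ?_
  · intro x _; simpa using ZMod.val_lt x
  · intro i _; simp
  · intro x _; simp
  · intro i hi; exact ZMod.val_cast_of_lt (by simpa using hi)
  · intro x _; simp

lemma sum_zmod_shift (f : ZMod (2 * l) → ℂ) (k : ZMod (2 * l)) :
    ∑ x, f (x + k) = ∑ x, f x :=
  Equiv.sum_comp (Equiv.addRight k) f

lemma sum_zmod_reflect (f : ZMod (2 * l) → ℂ) (k : ZMod (2 * l)) :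
    ∑ x, f (k - x) = ∑ x, f x :=
  Equiv.sum_comp (Equiv.subLeft k) f

lemma sum_Icc_eq_sum_zmod (f : ZMod (2 * l) → ℂ) :
    ∑ c ∈ Finset.Icc 1 (2 * l), f (c : ZMod (2 * l)) = ∑ x, f x := by
  rw [← sum_zmod_shift f 1, sum_zmod_eq_range, ← Finset.Ico_succ_right_eq_Icc,
    Finset.sum_Ico_eq_sum_range]
  simp [add_comm]

lemma sum_Icc_half_eq_sum_zmod (f : ZMod (2 * l) → ℂ) :
    ∑ c ∈ Finset.Icc 1 l, f (c : ZMod (2 * l)) + ∑ c ∈ Finset.Icc 1 l, f (1 - (c : ZMod (2 * l)))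
      = ∑ x, f x := by
  -- The shift lists the residues as 1 − l, …, l: the first half are the 1 − c, the second half the
  -- c.
  rw [← sum_zmod_shift f (1 - l), sum_zmod_eq_range,
    show Finset.range (2 * l) = Finset.range (l + l) by rw [two_mul], Finset.sum_range_add, add_comm,
    ← Finset.Ico_succ_right_eq_Icc, Finset.sum_Ico_eq_sum_range, Finset.sum_Ico_eq_sum_range]
  congr 1
  · rw [← Finset.sum_range_reflect]
    refine Finset.sum_congr (by simp) fun i hi => ?_
    have hi' : i < l := by simpa using hi
    congr 1
    have : ((l + 1 - 1 - 1 - i : ℕ) : ZMod (2 * l)) = l - 1 - i := by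
      rw [show l + 1 - 1 - 1 - i = l - (1 + i) by omega, Nat.cast_sub (by omega)]
      push_cast; ring
    simp only [Order.succ_eq_add_one] at *
    rw [Nat.cast_add, this]
    push_cast; ring
  · refine Finset.sum_congr (by simp) fun i _ => ?_
    congr 1
    push_cast; ring

/-- The parity character `c ↦ (-1)^c`. -/
def sgn (x : ZMod (2 * l)) : ℂ := (-1) ^ x.val

omit [NeZero l] in
lemma sgn_natCast (c : ℕ) : sgn (c : ZMod (2 * l)) = (-1) ^ c := by
  rw [sgn, ZMod.val_natCast, neg_one_pow_eq_pow_mod_two, neg_one_pow_eq_pow_mod_two (n := c),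
    Nat.mod_mul_right_mod]

omit [NeZero l] in
lemma sgn_mul_self (x : ZMod (2 * l)) : sgn x * sgn x = 1 := by
  rw [sgn, ← pow_add, ← two_mul, pow_mul]; simp

omit [NeZero l] in
lemma conj_sgn (x : ZMod (2 * l)) : conj (sgn x) = sgn x := by simp [sgn]

lemma sgn_add_one (x : ZMod (2 * l)) : sgn (x + 1) = -sgn x := by
  have : x + 1 = ((x.val + 1 : ℕ) : ZMod (2 * l)) := by simp
  rw [this, sgn_natCast, pow_succ, sgn]; ring

lemma sgn_sub_one (x : ZMod (2 * l)) : sgn (x - 1) = -sgn x := by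
  have := sgn_add_one (x - 1)
  rw [sub_add_cancel] at this
  rw [this, neg_neg]

lemma sgn_one_sub (x : ZMod (2 * l)) : sgn (1 - x) = -sgn x := by
  have h : ∀ n : ℕ, sgn (1 - (n : ZMod (2 * l))) = -(-1) ^ n := by
    intro n
    induction n with
    | zero =>
      have := sgn_natCast (l := l) 1
      simpa using this
    | succ n ih =>
      rw [Nat.cast_succ, ← sub_sub, sgn_sub_one, ih, pow_succ]; ring
  have := h x.val
  rwa [ZMod.natCast_zmod_val] at this

/-- From k to k + 1 every remainder drops by one, except at c = k, where 0 wraps to 2l − 1; the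
factor q matches all other terms. -/
lemma geometric_step (q : ℂ) (X : ZMod (2 * l) → ℂ) (k : ZMod (2 * l)) :
    ∑ c, q ^ (c - k).val * X c - q * ∑ c, q ^ (c - (k + 1)).val * X c
      = (1 - q ^ (2 * l)) * X k := by
  rw [Finset.mul_sum, ← Finset.sum_sub_distrib]
  rw [Finset.sum_eq_single k]
  · have h := val_neg_one_eq (l := l)
    rw [← sub_sub, sub_self, ZMod.val_zero]
    conv_rhs => rw [← h]
    ring
  · intro c _ hc
    have h := val_eq_val_sub_one_add_one (sub_ne_zero.mpr hc)
    rw [← sub_sub, h]; ring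
  · simp

lemma geometric_sum_by_parts (q : ℂ) (Y : ZMod (2 * l) → ℂ) (k : ZMod (2 * l)) :
    ∑ c, q ^ (c - k).val * (Y c - q * Y (c + 1)) = (1 - q ^ (2 * l)) * Y k := by
  rw [← geometric_step q Y k, ← sum_zmod_shift (fun c => q ^ (c - (k + 1)).val * Y c) 1,
    Finset.mul_sum, ← Finset.sum_sub_distrib]
  refine Finset.sum_congr rfl fun c _ => ?_
  rw [add_sub_add_right_eq_sub]; ring

/-- The same wrap-around with linear weights: each term contributes 1, and the jump at c = k costs
2l. -/
lemma linear_step (X : ZMod (2 * l) → ℂ) (k : ZMod (2 * l)) :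
    ∑ c, ((c - k).val : ℂ) * X c - ∑ c, ((c - (k + 1)).val : ℂ) * X c
      = ∑ c, X c - (2 * l) * X k := by
  have key : ∑ c, (((c - k).val : ℂ) * X c - ((c - (k + 1)).val : ℂ) * X c - X c)
      = -(2 * l) * X k := by
    rw [Finset.sum_eq_single k]
    · have h := val_neg_one_eq (l := l)
      have h' : ((((0 : ZMod (2 * l)) - 1).val : ℕ) : ℂ) + 1 = 2 * l := by exact_mod_cast h
      rw [← sub_sub, sub_self, ZMod.val_zero]
      push_cast
      linear_combination (-X k) * h'
    · intro c _ hc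
      have h := val_eq_val_sub_one_add_one (sub_ne_zero.mpr hc)
      rw [← sub_sub, h]; push_cast; ring
    · simp
  rw [Finset.sum_sub_distrib, Finset.sum_sub_distrib] at key
  linear_combination key

lemma linear_sum_by_parts (Y : ZMod (2 * l) → ℂ) (k : ZMod (2 * l)) :
    ∑ c, ((c - k).val : ℂ) * (Y c - Y (c + 1)) = ∑ c, Y c - (2 * l) * Y k := by
  rw [← linear_step Y k, ← sum_zmod_shift (fun c => ((c - (k + 1)).val : ℂ) * Y c) 1,
    ← Finset.sum_sub_distrib]
  refine Finset.sum_congr rfl fun c _ => ?_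
  rw [add_sub_add_right_eq_sub]; ring

/-- The reflection c ↦ 1 − c preserves the product and flips the parity. -/
lemma sum_sgn_mul_reflect (f : ZMod (2 * l) → ℂ) : ∑ c, sgn c * (f (1 - c) * f c) = 0 := by
  have h := sum_zmod_reflect (fun c => sgn c * (f (1 - c) * f c)) 1
  have h2 : ∑ c, sgn (1 - c) * (f (1 - (1 - c)) * f (1 - c))
      = -∑ c, sgn c * (f (1 - c) * f c) := by
    rw [← Finset.sum_neg_distrib]
    refine Finset.sum_congr rfl fun c _ => ?_
    rw [sgn_one_sub, sub_sub_cancel]; ring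
  have h3 := h2.symm.trans h
  linear_combination (-1 / 2) * h3

end Residues

/-! ### The bilinear identity -/

/-- The scalar relations satisfied by `v = diag V`, a Lax solution `H` at `λ = mu`, and its
`λ`-derivative `K`. -/
structure LaxData (l : ℕ) [NeZero l] (D : Set ℂ) (mu : ℂ) (v H K : ZMod (2 * l) → ℂ → ℂ) :
    Prop where
  isOpen : IsOpen D
  mu_ne : mu ≠ 0
  norm_mu_ne : ‖mu‖ ≠ 1
  v_ne : ∀ p c, v c p ≠ 0
  v_conj : ∀ p c, conj (v c p) = v c p
  v_reflect : ∀ p c, v c p * v (1 - c) p = 1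
  v_contDiffOn : ∀ c, ContDiffOn ℝ 2 (v c) D
  H_contDiffOn : ∀ c, ContDiffOn ℝ 2 (H c) D
  H_wirt : ∀ p ∈ D, ∀ c, HasWirt (H c) p (mu * H (c + 1) p + dz (v c) p / v c p * H c p)
    (mu⁻¹ * (v c p / v (c - 1) p * H (c - 1) p))
  K_wirt : ∀ p ∈ D, ∀ c, HasWirt (K c) p
    (H (c + 1) p + mu * K (c + 1) p + dz (v c) p / v c p * K c p)
    (mu⁻¹ * (v c p / v (c - 1) p * K (c - 1) p)
      - (mu ^ 2)⁻¹ * (v c p / v (c - 1) p * H (c - 1) p))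

section Potentials

variable {l : ℕ} [NeZero l] (mu : ℂ) (v H K : ZMod (2 * l) → ℂ → ℂ)

/-- The components of `V⁻¹ H`. -/
def scaled (c : ZMod (2 * l)) (p : ℂ) : ℂ := H c p / v c p

/-- The quadratic potential of `H` and its conjugate. -/
def hermPot (k : ZMod (2 * l)) (p : ℂ) : ℂ :=
  (1 - (-(mu * conj mu)) ^ (2 * l))⁻¹ *
    ∑ c, (-(mu * conj mu)) ^ (c - k).val * (H c p * conj (scaled v H c p))

/-- The quadratic potential of `H` with itself. -/
def skewPot (k : ZMod (2 * l)) (p : ℂ) : ℂ :=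
  (2 * l : ℂ)⁻¹ *
    ∑ c, sgn c * ((c - k).val * (H (1 - c) p * H c p) - mu * (K (1 - c) p * H c p))

/-- The tau function: the determinant of the potentials. -/
def tau (k : ZMod (2 * l)) (p : ℂ) : ℂ :=
  skewPot mu H K k p * conj (skewPot mu H K k p)
    - mu * conj mu * (hermPot mu v H (2 - k) p * hermPot mu v H k p)

/-- `∂_z` of `skewPot`. -/
def skewPotDz (k : ZMod (2 * l)) (p : ℂ) : ℂ := -(sgn k * mu) * (H k p * H (2 - k) p)

/-- `∂_{z̄}` of `skewPot`. -/
def skewPotDzbar (k : ZMod (2 * l)) (p : ℂ) : ℂ :=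
  -(sgn k * mu⁻¹) * (scaled v H (k - 1) p * scaled v H (1 - k) p)

/-- `∂_z` of `hermPot`. -/
def hermPotDz (k : ZMod (2 * l)) (p : ℂ) : ℂ :=
  (conj mu)⁻¹ * (H k p * conj (scaled v H (k - 1) p))

/-- `∂_z` of `tau`. -/
def tauDz (k : ZMod (2 * l)) (p : ℂ) : ℂ :=
  (skewPotDz mu H k p * conj (skewPot mu H K k p)
      + skewPot mu H K k p * conj (skewPotDzbar mu v H k p))
    - mu * conj mu * (hermPotDz mu v H (2 - k) p * hermPot mu v H k p
      + hermPot mu v H (2 - k) p * hermPotDz mu v H k p)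

variable {mu v H K} {D : Set ℂ}

/-! ### Shift relations and derivatives of the potentials. -/

namespace LaxData

lemma conj_mu_ne (h : LaxData l D mu v H K) : conj mu ≠ 0 := by
  simpa using h.mu_ne

lemma v_wirt (h : LaxData l D mu v H K) {p : ℂ} (hp : p ∈ D) (c : ZMod (2 * l)) :
    HasWirt (v c) p (dz (v c) p) (conj (dz (v c) p)) := by
  have h1 := HasWirt.of_differentiableAt
    ((h.v_contDiffOn c).differentiableOn (by norm_num) |>.differentiableAt (h.isOpen.mem_nhds hp))
  have h2 := h1.star
  simp only [h.v_conj] at h2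
  exact h1.congr_val rfl h2.dzbar

lemma dz_v_reflect (h : LaxData l D mu v H K) {p : ℂ} (hp : p ∈ D) (c : ZMod (2 * l)) :
    dz (v (1 - c)) p / v (1 - c) p = -(dz (v c) p / v c p) := by
  have h1 := (h.v_wirt hp c).mul (h.v_wirt hp (1 - c))
  simp only [h.v_reflect] at h1
  have h2 := h1.dz.symm.trans (HasWirt.const 1).dz
  have := h.v_ne p c
  have := h.v_ne p (1 - c)
  field_simp
  linear_combination h2

lemma v_one_sub (h : LaxData l D mu v H K) (p : ℂ) (c : ZMod (2 * l)) :
    v (1 - c) p = (v c p)⁻¹ :=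
  eq_inv_of_mul_eq_one_right (h.v_reflect p c)

lemma v_two_sub (h : LaxData l D mu v H K) (p : ℂ) (c : ZMod (2 * l)) :
    v (2 - c) p = (v (c - 1) p)⁻¹ := by
  rw [← h.v_one_sub]; congr 1; ring

lemma H_wirt' (h : LaxData l D mu v H K) {p : ℂ} (hp : p ∈ D) (c : ZMod (2 * l)) :
    HasWirt (H c) p (mu * H (c + 1) p + dz (v c) p / v c p * H c p)
    (mu⁻¹ * (v c p * scaled v H (c - 1) p)) :=
  (h.H_wirt p hp c).congr_val rfl (by rw [scaled]; ring)

/-- Dividing by v moves the connection term from ∂_z to ∂_{z̄}, with opposite sign, so it cancels in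
∂_z of H times the conjugate of `scaled`. -/
lemma scaled_wirt (h : LaxData l D mu v H K) {p : ℂ} (hp : p ∈ D) (c : ZMod (2 * l)) :
    HasWirt (scaled v H c) p (mu * (H (c + 1) p / v c p))
      (mu⁻¹ * scaled v H (c - 1) p - conj (dz (v c) p) / v c p * scaled v H c p) := by
  have h0 := h.v_ne p c
  refine ((h.H_wirt' hp c).div (h.v_wirt hp c) h0).congr_val ?_ ?_
  · field_simp; ring
  · simp only [scaled]; field_simp

lemma hermPot_ne (h : LaxData l D mu v H K) : 1 - (-(mu * conj mu)) ^ (2 * l) ≠ 0 := by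
  intro h0
  have h1 : ((‖mu‖ ^ (2 * (2 * l)) : ℝ) : ℂ) = 1 := by
    rw [Complex.mul_conj', Even.neg_pow ⟨l, two_mul l⟩, ← pow_mul] at h0
    push_cast
    linear_combination -h0
  have h2 : ‖mu‖ ^ (2 * (2 * l)) = 1 := by exact_mod_cast h1
  exact h.norm_mu_ne ((pow_eq_one_iff_of_nonneg (norm_nonneg _)
    (by have := NeZero.ne l; omega)).mp h2)

lemma hermPot_step (h : LaxData l D mu v H K) (k : ZMod (2 * l)) (p : ℂ) :
    hermPot mu v H k p = -(mu * conj mu) * hermPot mu v H (k + 1) p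
      + H k p * conj (scaled v H k p) := by
  have h1 := geometric_step (-(mu * conj mu)) (fun c => H c p * conj (scaled v H c p)) k
  have h0 := h.hermPot_ne
  simp only [hermPot]
  have h2 := inv_mul_cancel₀ h0
  generalize (1 - (-(mu * conj mu)) ^ (2 * l)) = N at *
  generalize ∑ c, (-(mu * conj mu)) ^ (c - k).val * (H c p * conj (scaled v H c p)) = S at *
  generalize ∑ c, (-(mu * conj mu)) ^ (c - (k + 1)).val * (H c p * conj (scaled v H c p)) = S' at *
  linear_combination N⁻¹ * h1 + H k p * conj (scaled v H k p) * h2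

/-- The total sum in `linear_step` vanishes by parity; only the jump at c = k survives. -/
lemma skewPot_step (k : ZMod (2 * l)) (p : ℂ) :
    skewPot mu H K (k + 1) p = skewPot mu H K k p + sgn k * (H (1 - k) p * H k p) := by
  have h1 := linear_step (fun c => sgn c * (H (1 - c) p * H c p)) k
  have h2 := sum_sgn_mul_reflect (fun c => H c p)
  have hl : (l : ℂ) ≠ 0 := by exact_mod_cast NeZero.ne l
  simp only [skewPot, mul_sub (sgn _), Finset.sum_sub_distrib]
  simp only [mul_left_comm (sgn _) (Nat.cast _ : ℂ)]
  generalize ∑ c, ((c - k).val : ℂ) * (sgn c * (H (1 - c) p * H c p)) = S at *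
  generalize ∑ c, ((c - (k + 1)).val : ℂ) * (sgn c * (H (1 - c) p * H c p)) = S' at *
  generalize ∑ c, sgn c * (mu * (K (1 - c) p * H c p)) = T at *
  rw [h2] at h1
  field_simp
  linear_combination -h1

/-- The unsimplified index c + 1 − 1 keeps the shape Y c − q Y (c + 1) required by
`geometric_sum_by_parts`. -/
lemma hermPot_wirt_aux (h : LaxData l D mu v H K) {p : ℂ} (hp : p ∈ D) (c : ZMod (2 * l)) :
    ∃ b, HasWirt (fun x => H c x * conj (scaled v H c x)) p
      ((conj mu)⁻¹ * (H c p * conj (scaled v H (c - 1) p)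
        - -(mu * conj mu) * (H (c + 1) p * conj (scaled v H (c + 1 - 1) p)))) b := by
  have h0 := h.v_ne p c
  have h1 := h.conj_mu_ne
  refine ⟨_, ((h.H_wirt' hp c).mul (h.scaled_wirt hp c).star).congr_val ?_ rfl⟩
  simp only [map_sub, map_mul, map_div₀, map_inv₀, h.v_conj, Complex.conj_conj, add_sub_cancel_right]
  field_simp
  ring

lemma hermPot_conj (h : LaxData l D mu v H K) (k : ZMod (2 * l)) (p : ℂ) :
    conj (hermPot mu v H k p) = hermPot mu v H k p := by
  simp only [hermPot, scaled, map_mul, map_inv₀, map_sub, map_pow, map_neg, map_sum, map_one,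
    Complex.conj_conj, map_div₀, h.v_conj]
  rw [mul_comm (conj mu) mu]
  congr 1
  exact Finset.sum_congr rfl fun c _ => by ring

lemma hermPot_wirt (h : LaxData l D mu v H K) {p : ℂ} (hp : p ∈ D) (k : ZMod (2 * l)) :
    HasWirt (hermPot mu v H k) p (hermPotDz mu v H k p) (conj (hermPotDz mu v H k p)) := by
  choose b hb using h.hermPot_wirt_aux hp
  obtain ⟨b', h1⟩ : ∃ b', HasWirt (hermPot mu v H k) p (hermPotDz mu v H k p) b' := by
    refine ⟨_, ((HasWirt.sum Finset.univ fun c =>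
      (hb c).const_mul ((-(mu * conj mu)) ^ (c - k).val)).const_mul
        (1 - (-(mu * conj mu)) ^ (2 * l))⁻¹).congr_val ?_ rfl⟩
    have h2 := geometric_sum_by_parts (-(mu * conj mu))
      (fun c => H c p * conj (scaled v H (c - 1) p)) k
    have h0 := h.hermPot_ne
    have h3 := h.conj_mu_ne
    simp only [mul_left_comm _ (conj mu)⁻¹]
    rw [← Finset.mul_sum, h2, hermPotDz]
    field_simp
  -- The potential is real, so its ∂_{z̄} is the conjugate of its ∂_z.
  have h2 := h1.star
  simp only [h.hermPot_conj] at h2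
  exact h1.congr_val rfl (h1.dzbar.symm.trans h2.dzbar)

/-- The inhomogeneous H terms in the derivatives of K cancel the total sum left by
`linear_sum_by_parts`; the remaining K terms telescope around the cycle. In ∂_z the connection terms
cancel because v_c v_{1−c} = 1. -/
lemma skewPot_wirt (h : LaxData l D mu v H K) {p : ℂ} (hp : p ∈ D) (k : ZMod (2 * l)) :
    HasWirt (skewPot mu H K k) p (skewPotDz mu H k p) (skewPotDzbar mu v H k p) := by
  have hl : (l : ℂ) ≠ 0 := by exact_mod_cast NeZero.ne l
  have hmu := h.mu_ne
  refine ((HasWirt.sum Finset.univ fun c =>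
    ((((h.H_wirt' hp (1 - c)).mul (h.H_wirt' hp c)).const_mul ((c - k).val : ℂ)).sub
      (((h.K_wirt p hp (1 - c)).mul (h.H_wirt' hp c)).const_mul mu)).const_mul
        (sgn c)).const_mul (2 * l : ℂ)⁻¹).congr_val ?_ ?_
  · have h1 := linear_sum_by_parts (fun c => sgn c * (H c p * H (2 - c) p)) k
    have h2 : ∑ c, (sgn c * (K (2 - c) p * H c p)
        - sgn (c + 1) * (K (2 - (c + 1)) p * H (c + 1) p)) = 0 := by
      rw [Finset.sum_sub_distrib,
        sum_zmod_shift (fun c => sgn c * (K (2 - c) p * H c p)) 1, sub_self]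
    have h3 : ∀ c, sgn c * (((c - k).val : ℂ) *
          ((mu * H (1 - c + 1) p + dz (v (1 - c)) p / v (1 - c) p * H (1 - c) p) * H c p
            + H (1 - c) p * (mu * H (c + 1) p + dz (v c) p / v c p * H c p))
        - mu * ((H (1 - c + 1) p + mu * K (1 - c + 1) p
            + dz (v (1 - c)) p / v (1 - c) p * K (1 - c) p) * H c p
            + K (1 - c) p * (mu * H (c + 1) p + dz (v c) p / v c p * H c p)))
        = mu * (((c - k).val : ℂ) * (sgn c * (H c p * H (2 - c) p)
            - sgn (c + 1) * (H (c + 1) p * H (2 - (c + 1)) p)))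
          - mu * (sgn c * (H c p * H (2 - c) p))
          - mu ^ 2 * (sgn c * (K (2 - c) p * H c p)
        - sgn (c + 1) * (K (2 - (c + 1)) p * H (c + 1) p)) := by
      intro c
      rw [sgn_add_one, h.dz_v_reflect hp, show 1 - c + 1 = 2 - c by ring,
        show 2 - (c + 1) = 1 - c by ring]
      ring
    simp only [h3]
    rw [Finset.sum_sub_distrib, Finset.sum_sub_distrib, ← Finset.mul_sum, ← Finset.mul_sum,
      ← Finset.mul_sum, h1, h2, skewPotDz]
    field_simp
    ring
  · set Z : ZMod (2 * l) → ℂ := fun c => sgn c * (scaled v H (c - 1) p * scaled v H (1 - c) p)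
      with hZ
    have h1 := linear_sum_by_parts Z k
    set R : ZMod (2 * l) → ℂ := fun c => sgn c * (K (1 - c) p / v (1 - c) p * scaled v H (c - 1) p)
      with hR
    have h2 : ∑ c, (R c - R (c + 1)) = 0 := by
      rw [Finset.sum_sub_distrib, sum_zmod_shift R 1, sub_self]
    have h3 : ∀ c, sgn c * (((c - k).val : ℂ) *
          (mu⁻¹ * (v (1 - c) p * scaled v H (1 - c - 1) p) * H c p
            + H (1 - c) p * (mu⁻¹ * (v c p * scaled v H (c - 1) p)))
        - mu * ((mu⁻¹ * (v (1 - c) p / v (1 - c - 1) p * K (1 - c - 1) p)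
            - (mu ^ 2)⁻¹ * (v (1 - c) p / v (1 - c - 1) p * H (1 - c - 1) p)) * H c p
            + K (1 - c) p * (mu⁻¹ * (v c p * scaled v H (c - 1) p))))
        = mu⁻¹ * (((c - k).val : ℂ) * (Z c - Z (c + 1))) - mu⁻¹ * Z (c + 1)
          - (R c - R (c + 1)) := by
      intro c
      simp only [hZ, hR, scaled, sgn_add_one, add_sub_cancel_right, h.v_one_sub p c,
        show 1 - (c + 1) = 1 - c - 1 by ring]
      have := h.v_ne p c
      have := h.v_ne p (c - 1)
      have := h.v_ne p (1 - c - 1)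
      field_simp
      ring
    simp only [h3]
    rw [Finset.sum_sub_distrib, Finset.sum_sub_distrib, ← Finset.mul_sum, ← Finset.mul_sum,
      h1, h2, sum_zmod_shift Z 1, skewPotDzbar]
    field_simp
    simp only [hZ]
    ring

lemma tau_wirt (h : LaxData l D mu v H K) {p : ℂ} (hp : p ∈ D) (k : ZMod (2 * l)) :
    HasWirt (tau mu v H K k) p (tauDz mu v H K k p) (conj (tauDz mu v H K k p)) := by
  refine (((h.skewPot_wirt hp k).mul (h.skewPot_wirt hp k).star).sub
    (((h.hermPot_wirt hp (2 - k)).mul (h.hermPot_wirt hp k)).const_mul (mu * conj mu))).congr_val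
    rfl ?_
  simp only [tauDz, map_sub, map_add, map_mul, Complex.conj_conj, h.hermPot_conj]
  ring

/-- The witness b is ∂_{z̄}∂_z τ. It contains no derivative of v, since ∂_{z̄} of H and ∂_z of
`scaled` contain none. -/
lemma tau_bilinear (h : LaxData l D mu v H K) {p : ℂ} (hp : p ∈ D) (k : ZMod (2 * l)) :
    ∃ a b, HasWirt (tauDz mu v H K k) p a b ∧
      tau mu v H K k p * b - tauDz mu v H K k p * conj (tauDz mu v H K k p)
        = v k p / v (k - 1) p *
          (tau mu v H K k p ^ 2 - tau mu v H K (k + 1) p * tau mu v H K (k - 1) p) := by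
  have hBz : HasWirt (skewPotDz mu H k) p _ _ :=
    ((h.H_wirt' hp k).mul (h.H_wirt' hp (2 - k))).const_mul (-(sgn k * mu))
  have hBzb : HasWirt (skewPotDzbar mu v H k) p _ _ :=
    ((h.scaled_wirt hp (k - 1)).mul (h.scaled_wirt hp (1 - k))).const_mul (-(sgn k * mu⁻¹))
  have hG : ∀ j, HasWirt (hermPotDz mu v H j) p _ _ := fun j =>
    ((h.H_wirt' hp j).mul (h.scaled_wirt hp (j - 1)).star).const_mul (conj mu)⁻¹
  refine ⟨_, _, ((hBz.mul (h.skewPot_wirt hp k).star).add ((h.skewPot_wirt hp k).mul hBzb.star)).sub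
    ((((hG (2 - k)).mul (h.hermPot_wirt hp k)).add
      ((h.hermPot_wirt hp (2 - k)).mul (hG k))).const_mul (mu * conj mu)), ?_⟩
  have hB1 := skewPot_step (mu := mu) (H := H) (K := K) k p
  have hB2 := skewPot_step (mu := mu) (H := H) (K := K) (k - 1) p
  have hG1 := h.hermPot_step k p
  have hG2 := h.hermPot_step (k - 1) p
  have hG3 := h.hermPot_step (2 - k) p
  have hG4 := h.hermPot_step (1 - k) p
  have hmu := h.mu_ne
  have hmu' := h.conj_mu_ne
  have hv := h.v_ne p k
  have hw := h.v_ne p (k - 1)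
  have hs := sgn_mul_self k
  rw [sub_add_cancel, sgn_sub_one] at hB2
  rw [sub_add_cancel] at hG2
  rw [show 1 - (k - 1) = 2 - k by ring] at hB2
  rw [show 1 - k + 1 = 2 - k by ring] at hG4
  -- The step relations are solved so that only B_k, G_k, G_{2−k} and the components at k, k − 1, 1
  -- − k, 2 − k remain.
  have e1 : skewPot mu H K (k - 1) p = skewPot mu H K k p + sgn k * (H (2 - k) p * H (k - 1) p) := by
    linear_combination -hB2
  have e2 : hermPot mu v H (k + 1) p = (H k p * conj (scaled v H k p) - hermPot mu v H k p)
      / (mu * conj mu) := by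
    field_simp; linear_combination hG1
  have e3 : hermPot mu v H (2 - k + 1) p =
      (H (2 - k) p * conj (scaled v H (2 - k) p) - hermPot mu v H (2 - k) p) / (mu * conj mu) := by
    field_simp; linear_combination hG3
  simp only [tau, tauDz]
  rw [show 2 - (k + 1) = 1 - k by ring, show 2 - (k - 1) = 2 - k + 1 by ring, hB1, e1, e2, e3,
    hG2, hG4]
  simp only [skewPotDz, skewPotDzbar, hermPotDz, scaled, map_sub, map_add, map_mul, map_neg,
    map_div₀, map_inv₀, Complex.conj_conj, h.v_conj, conj_sgn, h.hermPot_conj, sub_add_cancel,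
    h.v_one_sub, h.v_two_sub, show 1 - k + 1 = 2 - k by ring, show 2 - k - 1 = 1 - k by ring]
  clear hBz hBzb hG hB1 hB2 hG1 hG2 hG3 hG4 e1 e2 e3
  -- The rest is a rational identity in which a letter and its conjugate count as independent
  -- variables, subject only to s² = 1.
  generalize skewPot mu H K k p = B
  generalize hermPot mu v H k p = G
  generalize hermPot mu v H (2 - k) p = G'
  generalize sgn k = s at *
  generalize conj mu = mub at *
  generalize conj B = Bb
  generalize conj (H k p) = ab
  generalize conj (H (k - 1) p) = bb
  generalize conj (H (1 - k) p) = cb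
  generalize conj (H (2 - k) p) = db
  generalize H k p = a
  generalize H (k - 1) p = b
  generalize H (1 - k) p = c
  generalize H (2 - k) p = d
  generalize v k p = V at *
  generalize v (k - 1) p = W at *
  have hs2 : s ^ 2 = 1 := by rw [sq, hs]
  have hs3 : s ^ 3 = s := by linear_combination s * hs2
  have hs4 : s ^ 4 = 1 := by linear_combination (s ^ 2 + 1) * hs2
  field_simp
  ring_nf
  simp only [hs2, hs3, hs4]
  ring

/-! ### Regularity and reflection symmetry of the tau functions. -/

lemma scaled_contDiffOn (h : LaxData l D mu v H K) (c : ZMod (2 * l)) :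
    ContDiffOn ℝ 2 (scaled v H c) D := by
  have h1 := (h.H_contDiffOn c).mul ((h.v_contDiffOn c).inv fun x _ => h.v_ne x c)
  exact h1.congr fun p _ => div_eq_mul_inv _ _

lemma hermPot_contDiffOn (h : LaxData l D mu v H K) (k : ZMod (2 * l)) :
    ContDiffOn ℝ 2 (hermPot mu v H k) D := by
  refine contDiffOn_const.mul (ContDiffOn.sum fun c _ => contDiffOn_const.mul
    ((h.H_contDiffOn c).mul ?_))
  exact Complex.conjCLE.contDiff.comp_contDiffOn (h.scaled_contDiffOn c)

/-- K, a λ-derivative of a C² family, is a priori one order less regular; but both first derivatives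
of the potential involve only H and v. -/
lemma skewPot_contDiffOn (h : LaxData l D mu v H K) (k : ZMod (2 * l)) :
    ContDiffOn ℝ 2 (skewPot mu H K k) D := by
  refine contDiffOn_two_of_hasWirt h.isOpen (fun p hp => h.skewPot_wirt hp k) ?_ ?_
  · exact (contDiffOn_const.mul ((h.H_contDiffOn _).mul (h.H_contDiffOn _))).of_le (by norm_num)
  · exact (contDiffOn_const.mul ((h.scaled_contDiffOn _).mul (h.scaled_contDiffOn _))).of_le
      (by norm_num)

lemma tau_contDiffOn (h : LaxData l D mu v H K) (k : ZMod (2 * l)) :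
    ContDiffOn ℝ 2 (tau mu v H K k) D := by
  refine ((h.skewPot_contDiffOn k).mul ?_).sub
    (contDiffOn_const.mul ((h.hermPot_contDiffOn _).mul (h.hermPot_contDiffOn _)))
  exact Complex.conjCLE.contDiff.comp_contDiffOn (h.skewPot_contDiffOn k)

/-- Under c ↦ 1 − c the remainder r of c − k becomes 2l − 1 − r; the constant part is killed by
parity, and the two sign changes compensate. -/
lemma skewPot_reflect (k : ZMod (2 * l)) (p : ℂ) :
    skewPot mu H K (2 - k) p = skewPot mu H K k p := by
  have hval : ∀ x : ZMod (2 * l), (((-1 - x).val : ℕ) : ℂ) = 2 * l - 1 - x.val := by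
    intro x
    have h1 := val_neg_one_eq (l := l)
    rw [zero_sub] at h1
    have h2 := ZMod.val_lt x
    have h3 : (-1 - x).val + x.val + 1 = 2 * l := by
      rw [ZMod.val_sub (by omega)]; omega
    have h4 : (((-1 - x).val : ℕ) : ℂ) + x.val + 1 = 2 * l := by exact_mod_cast h3
    linear_combination h4
  have hH := sum_sgn_mul_reflect (fun c => H c p)
  -- The K part does not depend on k; this undoes the reflection applied to it.
  have hK : ∑ c, sgn c * (mu * (K c p * H (1 - c) p)) =
      -∑ c, sgn c * (mu * (K (1 - c) p * H c p)) := by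
    rw [← sum_zmod_reflect _ 1, ← Finset.sum_neg_distrib]
    refine Finset.sum_congr rfl fun c _ => ?_
    rw [sgn_one_sub, sub_sub_cancel]; ring
  rw [skewPot, skewPot, ← sum_zmod_reflect _ 1]
  congr 1
  have hterm : ∀ c, sgn (1 - c) * (((1 - c - (2 - k)).val : ℂ) * (H (1 - (1 - c)) p * H (1 - c) p)
        - mu * (K (1 - (1 - c)) p * H (1 - c) p))
      = sgn c * ((c - k).val * (H (1 - c) p * H c p)) - (2 * l - 1) * (sgn c * (H (1 - c) p * H c p))
        + sgn c * (mu * (K c p * H (1 - c) p)) := by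
    intro c
    rw [sgn_one_sub, sub_sub_cancel, show 1 - c - (2 - k) = -1 - (c - k) by ring, hval]
    ring
  simp only [hterm, mul_sub (sgn _)]
  rw [Finset.sum_add_distrib, Finset.sum_sub_distrib, Finset.sum_sub_distrib, ← Finset.mul_sum, hH,
    hK]
  ring

lemma tau_reflect (k : ZMod (2 * l)) (p : ℂ) :
    tau mu v H K (2 - k) p = tau mu v H K k p := by
  rw [tau, tau, skewPot_reflect, sub_sub_cancel, mul_comm (hermPot mu v H k p)]

end LaxData
end Potentials

/-! ### The Laplacian of a logarithm -/

lemma HasWirt.log {g : ℂ → ℝ} {x a b : ℂ} (h : HasWirt (fun y => (g y : ℂ)) x a b)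
    (hg : DifferentiableAt ℝ g x) (h0 : g x ≠ 0) :
    HasWirt (fun y => (Real.log (g y) : ℂ)) x (a / g x) (b / g x) := by
  have h1 := (Complex.ofRealCLM.hasFDerivAt.comp x (hg.hasFDerivAt.log h0))
  have h2 := HasFDerivAt.unique (Complex.ofRealCLM.hasFDerivAt.comp x hg.hasFDerivAt) h
  refine h1.congr_fderiv ?_
  ext e
  have h3 := congrArg (fun L : ℂ →L[ℝ] ℂ => L e) h2
  simp [wirt_apply] at h3 ⊢
  rw [h3]
  ring

/-- `Real.log` is log|·|, so g ≠ 0 suffices and the sign of g is irrelevant. -/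
lemma laplacian_log {D : Set ℂ} (hD : IsOpen D) {g : ℂ → ℝ} (hg : ContDiffOn ℝ 2 g D)
    {a b : ℂ → ℂ} (ha : ∀ x ∈ D, HasWirt (fun y => (g y : ℂ)) x (a x) (b x))
    {p c d : ℂ} (hp : p ∈ D) (h0 : g p ≠ 0) (hc : HasWirt a p c d) :
    ((Laplacian.laplacian (fun x => Real.log (g x)) p : ℝ) : ℂ)
      = (g p * d - a p * b p) / (g p) ^ 2 := by
  have hgp : ContDiffAt ℝ 2 g p := hg.contDiffAt (hD.mem_nhds hp)
  have hlog : ContDiffAt ℝ 2 (fun x => Real.log (g x)) p := hgp.log h0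
  have h1 := hlog.laplacian_CLM_comp_left (l := Complex.ofRealCLM)
  have h2 : ContDiffAt ℝ 2 (fun x => (Real.log (g x) : ℂ)) p :=
    Complex.ofRealCLM.contDiff.contDiffAt.comp p hlog
  have h0' : (g p : ℂ) ≠ 0 := by exact_mod_cast h0
  have h3 : ∀ᶠ x in 𝓝 p, HasWirt (fun x => (Real.log (g x) : ℂ)) x (a x / g x) (b x / g x) := by
    filter_upwards [hD.mem_nhds hp, hgp.continuousAt.eventually_ne h0] with x hx hx0
    exact (ha x hx).log ((hg.differentiableOn (by norm_num)).differentiableAt (hD.mem_nhds hx)) hx0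
  have h4 := laplacian_eq_of_hasWirt h2 h3 (hc.div (ha p hp) h0')
  have h5 : ((Laplacian.laplacian (fun x => Real.log (g x)) p : ℝ) : ℂ)
      = Laplacian.laplacian (fun x => (Real.log (g x) : ℂ)) p := h1.symm
  rw [h5, h4]
  ring

/-! ### The Lax pair in components -/

section Lax

variable {l : ℕ} [NeZero l]

lemma one_sub_val_cases (hl : 2 ≤ l) (c : ZMod (2 * l)) :
    (1 ≤ c.val ∧ c.val ≤ l ∧ ¬(1 ≤ (1 - c).val ∧ (1 - c).val ≤ l)) ∨
    (¬(1 ≤ c.val ∧ c.val ≤ l) ∧ 1 ≤ (1 - c).val ∧ (1 - c).val ≤ l) := by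
  have : Fact (1 < 2 * l) := ⟨by omega⟩
  have h1 : (1 : ZMod (2 * l)).val = 1 := ZMod.val_one _
  have hc := ZMod.val_lt c
  rcases Nat.lt_or_ge 1 c.val with h | h
  · have h2 : (1 - c).val = 2 * l - (c.val - 1) := by
      rw [show 1 - c = -(c - 1) by ring, ZMod.neg_val, ZMod.val_sub (by omega), h1, if_neg]
      intro h0
      have := congrArg ZMod.val h0
      rw [ZMod.val_sub (by omega), h1, ZMod.val_zero] at this
      omega
    omega
  · have h2 : (1 - c).val = 1 - c.val := by rw [ZMod.val_sub (by omega), h1]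
    omega

omit [NeZero l] in
lemma vdiag_natCast (u : ℕ → ℂ → ℝ) (p : ℂ) {c : ℕ} (h1 : 1 ≤ c) (h2 : c ≤ l) :
    vdiag l u p (c : ZMod (2 * l)) = Real.exp (u c p) := by
  have : (c : ZMod (2 * l)).val = c := ZMod.val_cast_of_lt (by omega)
  simp [vdiag, this, h1, h2]

lemma vdiag_one_sub (hl : 2 ≤ l) (u : ℕ → ℂ → ℝ) (p : ℂ) (c : ZMod (2 * l)) :
    vdiag l u p c * vdiag l u p (1 - c) = 1 := by
  rcases one_sub_val_cases hl c with ⟨h1, h2, h3⟩ | ⟨h1, h2⟩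
  · rw [vdiag, vdiag, if_pos ⟨h1, h2⟩, if_neg h3, sub_sub_cancel]
    rw [← Complex.ofReal_mul, ← Real.exp_add]; simp
  · rw [vdiag, vdiag, if_neg h1, if_pos h2]
    rw [← Complex.ofReal_mul, ← Real.exp_add]; simp

omit [NeZero l] in
lemma vdiag_ne_zero (u : ℕ → ℂ → ℝ) (p : ℂ) (c : ZMod (2 * l)) : vdiag l u p c ≠ 0 := by
  unfold vdiag; split_ifs <;> exact_mod_cast Real.exp_ne_zero _

omit [NeZero l] in
lemma conj_vdiag (u : ℕ → ℂ → ℝ) (p : ℂ) (c : ZMod (2 * l)) :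
    conj (vdiag l u p c) = vdiag l u p c := by
  unfold vdiag; split_ifs <;> exact Complex.conj_ofReal _

lemma vdiag_contDiffOn (hl : 2 ≤ l) {D : Set ℂ} {u : ℕ → ℂ → ℝ}
    (hu : ∀ j, 1 ≤ j → j ≤ l → ContDiffOn ℝ 2 (u j) D) (c : ZMod (2 * l)) :
    ContDiffOn ℝ 2 (fun p => vdiag l u p c) D := by
  unfold vdiag
  rcases one_sub_val_cases hl c with ⟨h1, h2, _⟩ | ⟨h1, h2⟩
  · simp only [h1, h2, and_self, if_true]
    exact Complex.ofRealCLM.contDiff.comp_contDiffOn (hu _ h1 h2).exp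
  · simp only [h1, if_false]
    exact Complex.ofRealCLM.contDiff.comp_contDiffOn (hu _ h2.1 h2.2).neg.exp

lemma matV_inv (u : ℕ → ℂ → ℝ) (p : ℂ) :
    (matV l u p)⁻¹ = Matrix.diagonal (fun j => (vdiag l u p j)⁻¹) := by
  rw [matV]
  refine Matrix.inv_eq_right_inv ?_
  rw [Matrix.diagonal_mul_diagonal, ← Matrix.diagonal_one]
  congr 1
  ext j
  exact mul_inv_cancel₀ (vdiag_ne_zero u p j)

lemma lax_dz_component {D : Set ℂ} {u : ℕ → ℂ → ℝ} (hv : ∀ p ∈ D, DifferentiableAt ℝ (vdiag l u) p)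
    {lam p : ℂ} (hp : p ∈ D) (h : ZMod (2 * l) → ℂ) (c : ZMod (2 * l)) :
    ((lam • matJ l + matP l u p) *ᵥ h) c
      = lam * h (c + 1) + dz (fun x => vdiag l u x c) p / vdiag l u p c * h c := by
  have hdz : dz (vdiag l u) p c = dz (fun x => vdiag l u x c) p := by
    have h1 : ∀ e, fderiv ℝ (fun x => vdiag l u x c) p e = fderiv ℝ (vdiag l u) p e c := by
      intro e
      rw [fderiv_apply (hv p hp)]
      rfl
    simp [dz, h1]
  rw [Matrix.add_mulVec, Matrix.smul_mulVec, matP, matV_inv, Matrix.diagonal_mul_diagonal]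
  simp only [Pi.add_apply, Pi.smul_apply, Matrix.mulVec_diagonal, smul_eq_mul, hdz]
  congr 1
  simp [Matrix.mulVec, dotProduct, matJ]

lemma lax_dzbar_component (u : ℕ → ℂ → ℝ) (lam p : ℂ) (h : ZMod (2 * l) → ℂ) (c : ZMod (2 * l)) :
    ((lam⁻¹ • matQ l u p) *ᵥ h) c
      = lam⁻¹ * (vdiag l u p c / vdiag l u p (c - 1) * h (c - 1)) := by
  rw [Matrix.smul_mulVec, matQ, matV_inv, matV]
  simp only [Pi.smul_apply, smul_eq_mul]
  congr 1
  simp only [Matrix.mulVec, dotProduct, Matrix.mul_diagonal, Matrix.diagonal_mul,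
    Matrix.transpose_apply, matJ, Matrix.of_apply]
  rw [Finset.sum_eq_single (c - 1)]
  · rw [sub_add_cancel, if_pos rfl, mul_one]; ring
  · intro b _ hb
    have : b + 1 ≠ c := fun h => hb (by rw [← h]; ring)
    simp [this]
  · simp

lemma IsLaxSolution.hasWirt {D : Set ℂ} (hD : IsOpen D) {u : ℕ → ℂ → ℝ} {lam : ℂ}
    {φ : ℂ → ZMod (2 * l) → ℂ} (hv : ∀ p ∈ D, DifferentiableAt ℝ (vdiag l u) p)
    (h : IsLaxSolution l D u lam φ) {p : ℂ} (hp : p ∈ D) (c : ZMod (2 * l)) :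
    HasWirt (fun x => φ x c) p
      (lam * φ p (c + 1) + dz (fun x => vdiag l u x c) p / vdiag l u p c * φ p c)
      (lam⁻¹ * (vdiag l u p c / vdiag l u p (c - 1) * φ p (c - 1))) := by
  have hφ : DifferentiableAt ℝ φ p := h.1.differentiableAt (hD.mem_nhds hp)
  have h1 : ∀ e, fderiv ℝ (fun x => φ x c) p e = fderiv ℝ φ p e c := by
    intro e
    rw [fderiv_apply hφ]
    rfl
  obtain ⟨h2, h3⟩ := h.2 p hp
  refine (HasWirt.of_differentiableAt (differentiableAt_pi.mp hφ c)).congr_val ?_ ?_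
  · rw [← lax_dz_component hv hp (φ p) c, ← h2]
    simp [dz, h1]
  · rw [← lax_dzbar_component u lam p (φ p) c, ← h3]
    simp [dzbar, h1]

lemma laxData_of_lax (hl : 2 ≤ l) {D : Set ℂ} (hD : IsOpen D) {u : ℕ → ℂ → ℝ}
    (hu : ∀ j, 1 ≤ j → j ≤ l → ContDiffOn ℝ 2 (u j) D) {mu : ℂ} (hmu : mu ≠ 0) (hmu1 : ‖mu‖ ≠ 1)
    {S : Set ℂ} (hS : IsOpen S) (hmuS : mu ∈ S) {Φ : ℂ → ℂ → ZMod (2 * l) → ℂ}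
    (hreg : ContDiffOn ℝ 2 (fun q : ℂ × ℂ => Φ q.1 q.2) (S ×ˢ D))
    (hhol : ∀ p ∈ D, DifferentiableOn ℂ (fun lam => Φ lam p) S)
    (hLax : ∀ lam ∈ S, lam ≠ 0 → IsLaxSolution l D u lam (Φ lam)) :
    LaxData l D mu (fun c p => vdiag l u p c) (fun c p => Φ mu p c)
      (fun c p => deriv (fun lam => Φ lam p) mu c) := by
  have hvs := vdiag_contDiffOn hl hu
  have hv : ∀ p ∈ D, DifferentiableAt ℝ (vdiag l u) p := fun p hp =>
    differentiableAt_pi.mpr fun c =>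
      ((hvs c).differentiableOn (by norm_num)).differentiableAt (hD.mem_nhds hp)
  have hcomp : ∀ c, ContDiffOn ℝ 2 (fun q : ℂ × ℂ => Φ q.1 q.2 c) (S ×ˢ D) :=
    contDiffOn_pi.mp hreg
  have hholc : ∀ p ∈ D, ∀ c, HasDerivAt (fun lam => Φ lam p c)
      (deriv (fun lam => Φ lam p) mu c) mu := fun p hp c =>
    hasDerivAt_pi.mp ((hhol p hp).differentiableAt (hS.mem_nhds hmuS)).hasDerivAt c
  refine ⟨hD, hmu, hmu1, fun p c => vdiag_ne_zero u p c, fun p c => conj_vdiag u p c,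
    fun p c => vdiag_one_sub hl u p c, hvs, ?_, ?_, ?_⟩
  · intro c
    exact (hcomp c).comp (contDiff_prodMk_right mu).contDiffOn fun p hp => ⟨hmuS, hp⟩
  · intro p hp c
    exact (hLax mu hmuS hmu).hasWirt hD hv hp c
  · intro p hp c
    have hF : ∀ x ∈ D, ContDiffAt ℝ 2 (fun q : ℂ × ℂ => Φ q.1 q.2 c) (mu, x) := fun x hx =>
      (hcomp c).contDiffAt ((hS.prod hD).mem_nhds ⟨hmuS, hx⟩)
    have hnear : ∀ᶠ lam in 𝓝 mu, HasWirt (fun x => Φ lam x c) p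
        (lam * Φ lam p (c + 1) + dz (fun x => vdiag l u x c) p / vdiag l u p c * Φ lam p c)
        (lam⁻¹ * (vdiag l u p c / vdiag l u p (c - 1) * Φ lam p (c - 1))) := by
      filter_upwards [hS.mem_nhds hmuS, isOpen_ne.mem_nhds hmu] with lam h1 h2
      exact (hLax lam h1 h2).hasWirt hD hv hp c
    have hα := ((hasDerivAt_id mu).mul (hholc p hp (c + 1))).add
      ((hholc p hp c).const_mul (dz (fun x => vdiag l u x c) p / vdiag l u p c))
    have hβ := (hasDerivAt_inv hmu).mul
      ((hholc p hp (c - 1)).const_mul (vdiag l u p c / vdiag l u p (c - 1)))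
    have key := hasWirt_fderiv_fst (hF p hp) hnear hα hβ
    -- Holomorphy identifies the complex λ-derivative with the real derivative in the direction (1,
    -- 0).
    have heq : (fun x => deriv (fun lam => Φ lam x) mu c) =ᶠ[𝓝 p]
        fun x => fderiv ℝ (fun q : ℂ × ℂ => Φ q.1 q.2 c) (mu, x) (1, 0) := by
      filter_upwards [hD.mem_nhds hp] with x hx
      have h1 := ((hF x hx).differentiableAt (by norm_num)).hasFDerivAt.comp mu
        (hasFDerivAt_prodMk_left (𝕜 := ℝ) mu x)
      have h2 := (hholc x hx c).hasFDerivAt.restrictScalars ℝ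
      have h3 := congrArg (fun L : ℂ →L[ℝ] ℂ => L 1) (HasFDerivAt.unique h2 h1)
      simpa using h3
    refine (key.congr_fun heq).congr_val ?_ ?_
    · simp
    · ring

end Lax

/-! ### The functions `g_j` as tau functions -/

section Tau

variable {l : ℕ} [NeZero l]

/-- The index reverses because j + c − 2 = c − (2 − j) and j − c − 1 = (1 − c) − (2 − j). -/
lemma gam_eq_hermPot (hl : 2 ≤ l) (mu : ℂ) (u : ℕ → ℂ → ℝ) (Φ : ℂ → ℂ → ZMod (2 * l) → ℂ)
    (p : ℂ) (j : ℤ) :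
    (gam l mu u (Φ mu p) p j : ℂ)
      = hermPot mu (fun c p => vdiag l u p c) (fun c p => Φ mu p c) (2 - j) p := by
  have hq : ((-‖mu‖ ^ 2 : ℝ) : ℂ) = -(mu * conj mu) := by
    rw [Complex.mul_conj']; push_cast; ring
  rw [hermPot, ← sum_Icc_half_eq_sum_zmod, gam]
  have h1 : (‖mu‖ ^ (4 * l) : ℝ) = (-‖mu‖ ^ 2) ^ (2 * l) := by
    rw [Even.neg_pow ⟨l, two_mul l⟩, ← pow_mul]; congr 1; ring
  rw [h1, one_div]
  push_cast [← hq]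
  congr 2
  · refine Finset.sum_congr rfl fun c hc => ?_
    rw [Finset.mem_Icc] at hc
    rw [rem_eq_val, scaled, map_div₀, conj_vdiag, vdiag_natCast u p hc.1 hc.2, comp, mul_assoc,
      ← Complex.mul_conj' (Φ mu p _), Complex.exp_neg, Complex.ofReal_exp]
    congr 1
    · congr 2; push_cast; ring
    · rw [Int.cast_natCast]; ring
  · refine Finset.sum_congr rfl fun c hc => ?_
    rw [Finset.mem_Icc] at hc
    have h2 := vdiag_one_sub hl u p (c : ZMod (2 * l))
    rw [vdiag_natCast u p hc.1 hc.2, Complex.ofReal_exp] at h2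
    have h3 := vdiag_ne_zero u p (1 - (c : ZMod (2 * l)))
    rw [rem_eq_val, scaled, map_div₀, conj_vdiag, comp, mul_assoc, ← Complex.mul_conj' (Φ mu p _),
      eq_inv_of_mul_eq_one_left h2]
    congr 1
    · congr 2; push_cast; ring
    · simp only [Int.cast_sub, Int.cast_one, Int.cast_natCast]
      field_simp

lemma gOf_eq_tau (hl : 2 ≤ l) (mu : ℂ) (u : ℕ → ℂ → ℝ) (Φ : ℂ → ℂ → ZMod (2 * l) → ℂ)
    (p : ℂ) (j : ℤ) :
    (gOf l mu u Φ j p : ℂ)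
      = tau mu (fun c p => vdiag l u p c) (fun c p => Φ mu p c)
        (fun c p => deriv (fun lam => Φ lam p) mu c) j p := by
  have h1 : ∑ c ∈ Finset.Icc 1 (2 * l), (-1 : ℂ) ^ c *
      ((rem l (c - j) : ℂ) * comp (Φ mu p) (1 - c) * comp (Φ mu p) c
        - mu * comp (deriv (fun lam => Φ lam p) mu) (1 - c) * comp (Φ mu p) c)
      = 2 * l * skewPot mu (fun c p => Φ mu p c) (fun c p => deriv (fun lam => Φ lam p) mu c)
        (j : ZMod (2 * l)) p := by
    have hl0 : (2 * l : ℂ) ≠ 0 := mul_ne_zero two_ne_zero (by exact_mod_cast NeZero.ne l)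
    rw [skewPot, mul_inv_cancel_left₀ hl0, ← sum_Icc_eq_sum_zmod]
    refine Finset.sum_congr rfl fun c _ => ?_
    rw [rem_eq_val, sgn_natCast, comp, comp, comp]
    push_cast
    ring
  rw [gOf, gfun, h1, tau]
  have h2 := gam_eq_hermPot hl mu u Φ p j
  have h3 := gam_eq_hermPot hl mu u Φ p (2 - j)
  push_cast at h3
  rw [sub_sub_cancel] at h3
  push_cast
  rw [← h2, ← h3, ← Complex.mul_conj', Complex.mul_conj' mu]
  have hl0 : (l : ℂ) ≠ 0 := by exact_mod_cast NeZero.ne l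
  simp only [map_mul, Complex.conj_natCast, Complex.conj_ofNat]
  field_simp
  ring

end Tau

/-! ### The Toda equation for the transformed functions -/

section Transformed

variable {l : ℕ} [NeZero l] {D : Set ℂ} {u : ℕ → ℂ → ℝ} {mu : ℂ} {Φ : ℂ → ℂ → ZMod (2 * l) → ℂ}

/-- A congruence modulo 2l as hypothesis covers both ends: (j, k) = (0, 2) and (l + 2, l). -/
lemma gOf_reflect (hl : 2 ≤ l) {j k : ℤ} (hjk : (j : ZMod (2 * l)) = 2 - k) (p : ℂ) :
    gOf l mu u Φ j p = gOf l mu u Φ k p := by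
  have h : (gOf l mu u Φ j p : ℂ) = gOf l mu u Φ k p := by
    rw [gOf_eq_tau hl, gOf_eq_tau hl, hjk, LaxData.tau_reflect]
  exact_mod_cast h

lemma gOf_contDiffOn (hl : 2 ≤ l)
    (h : LaxData l D mu (fun c p => vdiag l u p c) (fun c p => Φ mu p c)
      (fun c p => deriv (fun lam => Φ lam p) mu c)) (j : ℤ) :
    ContDiffOn ℝ 2 (gOf l mu u Φ j) D := by
  refine (Complex.reCLM.contDiff.comp_contDiffOn (h.tau_contDiffOn j)).congr fun p _ => ?_
  simp [← gOf_eq_tau hl]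

lemma laplacian_log_gOf (hl : 2 ≤ l)
    (h : LaxData l D mu (fun c p => vdiag l u p c) (fun c p => Φ mu p c)
      (fun c p => deriv (fun lam => Φ lam p) mu c)) {p : ℂ} (hp : p ∈ D) (j : ℤ)
    (h0 : gOf l mu u Φ j p ≠ 0) {e : ℝ}
    (he : (e : ℂ) = vdiag l u p (j : ZMod (2 * l)) / vdiag l u p ((j : ZMod (2 * l)) - 1)) :
    Laplacian.laplacian (fun x => Real.log (gOf l mu u Φ j x)) p
      = e * (1 - gOf l mu u Φ (j + 1) p * gOf l mu u Φ (j - 1) p / gOf l mu u Φ j p ^ 2) := by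
  obtain ⟨a, b, hab, hbil⟩ := h.tau_bilinear hp (j : ZMod (2 * l))
  have h1 := laplacian_log h.isOpen (gOf_contDiffOn hl h j)
    (fun x hx => by
      simp only [gOf_eq_tau hl]
      exact h.tau_wirt hx (j : ZMod (2 * l))) hp h0 hab
  have e1 := gOf_eq_tau hl mu u Φ p (j + 1)
  have e2 := gOf_eq_tau hl mu u Φ p (j - 1)
  push_cast at e1 e2
  rw [← e1, ← e2, ← he, ← gOf_eq_tau hl] at hbil
  rw [hbil] at h1
  have h2 : Laplacian.laplacian (fun x => Real.log (gOf l mu u Φ j x)) p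
      = e * (gOf l mu u Φ j p ^ 2 - gOf l mu u Φ (j + 1) p * gOf l mu u Φ (j - 1) p)
        / gOf l mu u Φ j p ^ 2 := by exact_mod_cast h1
  rw [h2]
  field_simp

lemma laplacian_add_log_div {f g₁ g₂ : ℂ → ℝ} {p : ℂ} (hf : ContDiffAt ℝ 2 f p)
    (h₁ : ContDiffAt ℝ 2 g₁ p) (h₂ : ContDiffAt ℝ 2 g₂ p) (n₁ : g₁ p ≠ 0) (n₂ : g₂ p ≠ 0) :
    Laplacian.laplacian (fun x => f x + Real.log (g₂ x / g₁ x)) p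
      = Laplacian.laplacian f p + (Laplacian.laplacian (fun x => Real.log (g₂ x)) p
        - Laplacian.laplacian (fun x => Real.log (g₁ x)) p) := by
  have hcongr : (fun x => f x + Real.log (g₂ x / g₁ x)) =ᶠ[𝓝 p]
      f + ((fun x => Real.log (g₂ x)) - fun x => Real.log (g₁ x)) := by
    filter_upwards [h₁.continuousAt.eventually_ne n₁, h₂.continuousAt.eventually_ne n₂] with x a b
    simp [Real.log_div b a]
  have hadd : Laplacian.laplacian (f + ((fun x => Real.log (g₂ x)) - fun x => Real.log (g₁ x))) p
      = _ := hf.laplacian_add ((h₂.log n₂).sub (h₁.log n₁))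
  have hsub := (h₂.log n₂).laplacian_sub (h₁.log n₁)
  rw [(InnerProductSpace.laplacian_congr_nhds hcongr).eq_of_nhds, hadd]
  exact congrArg _ hsub

lemma exp_add_log_sub {a b r s : ℝ} (hr : 0 < r) (hs : 0 < s) :
    Real.exp (a + Real.log r - (b + Real.log s)) = Real.exp (a - b) * (r / s) := by
  rw [← Real.exp_log (div_pos hr hs), ← Real.exp_add, Real.log_div hr.ne' hs.ne']
  congr 1
  ring

lemma exp_two_mul_add_log {a r : ℝ} (hr : 0 < r) :
    Real.exp (2 * (a + Real.log r)) = Real.exp (2 * a) * r ^ 2 := by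
  rw [mul_add, Real.exp_add, ← Real.log_rpow hr, Real.exp_log (by positivity), Real.rpow_two]

lemma exp_neg_two_mul_add_log {a r : ℝ} (hr : 0 < r) :
    Real.exp (-2 * (a + Real.log r)) = Real.exp (-2 * a) / r ^ 2 := by
  rw [neg_mul, Real.exp_neg, exp_two_mul_add_log hr, neg_mul, Real.exp_neg]
  field_simp

end Transformed

end EllipticToda

end

/-! ### Assembly of the transformed Toda equations. -/

theorem mainTheorem6 (l : ℕ) [NeZero l] (hl : 2 ≤ l)
    (D : Set ℂ) (hD : IsOpen D)
    (u : ℕ → ℂ → ℝ) (hu : EllipticToda.IsTodaSolution l D u)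
    (mu : ℂ) (hmu : mu ≠ 0) (hmu1 : ‖mu‖ ≠ 1)
    (S : Set ℂ) (hS : IsOpen S) (hmuS : mu ∈ S)
    (Φ : ℂ → ℂ → ZMod (2 * l) → ℂ)
    (hreg : ContDiffOn ℝ 2 (fun q : ℂ × ℂ => Φ q.1 q.2) (S ×ˢ D))
    (hhol : ∀ p ∈ D, DifferentiableOn ℂ (fun lam => Φ lam p) S)
    (hLax : ∀ lam ∈ S, lam ≠ 0 → EllipticToda.IsLaxSolution l D u lam (Φ lam))
    (hpos : ∀ p ∈ D, ∀ j : ℕ, 1 ≤ j → j ≤ l →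
      0 < EllipticToda.gOf l mu u Φ (j + 1) p / EllipticToda.gOf l mu u Φ j p) :
    EllipticToda.IsTodaSolution l D
      (fun j p => u j p +
        Real.log (EllipticToda.gOf l mu u Φ (j + 1) p / EllipticToda.gOf l mu u Φ j p)) := by
  have hdat := EllipticToda.laxData_of_lax hl hD hu.1 hmu hmu1 hS hmuS hreg hhol hLax
  set G : ℤ → ℂ → ℝ := EllipticToda.gOf l mu u Φ with hG
  have hGs : ∀ j, ContDiffOn ℝ 2 (G j) D := EllipticToda.gOf_contDiffOn hl hdat
  -- Since x / 0 = 0, a positive ratio forces both entries to be nonzero; their common sign stays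
  -- unknown.
  have hne : ∀ p ∈ D, ∀ j : ℕ, 1 ≤ j → j ≤ l → G j p ≠ 0 ∧ G (j + 1) p ≠ 0 := by
    intro p hp j h1 h2
    have h3 := (hpos p hp j h1 h2).ne'
    exact ⟨(div_ne_zero_iff.mp h3).2, (div_ne_zero_iff.mp h3).1⟩
  have hlap : ∀ p ∈ D, ∀ j : ℕ, 1 ≤ j → j ≤ l →
      Laplacian.laplacian (fun x => u j x + Real.log (G (j + 1) x / G j x)) p
        = Laplacian.laplacian (u j) p
          + (Laplacian.laplacian (fun x => Real.log (G (j + 1) x)) p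
            - Laplacian.laplacian (fun x => Real.log (G j x)) p) := by
    intro p hp j h1 h2
    have hn := hD.mem_nhds hp
    exact EllipticToda.laplacian_add_log_div ((hu.1 j h1 h2).contDiffAt hn)
      ((hGs _).contDiffAt hn) ((hGs _).contDiffAt hn) (hne p hp j h1 h2).1 (hne p hp j h1 h2).2
  have hlog : ∀ p ∈ D, ∀ j : ℤ, G j p ≠ 0 → ∀ e : ℝ,
      (e : ℂ) = EllipticToda.vdiag l u p (j : ZMod (2 * l))
        / EllipticToda.vdiag l u p ((j : ZMod (2 * l)) - 1) →
      Laplacian.laplacian (fun x => Real.log (G j x)) p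
        = e * (1 - G (j + 1) p * G (j - 1) p / G j p ^ 2) :=
    fun p hp j h0 e he => EllipticToda.laplacian_log_gOf hl hdat hp j h0 he
  have hlogMid : ∀ p ∈ D, ∀ j : ℕ, 1 ≤ j → j + 1 ≤ l →
      Laplacian.laplacian (fun x => Real.log (G (j + 1) x)) p
        = Real.exp (u (j + 1) p - u j p) *
          (1 - G (j + 1 + 1) p * G j p / G (j + 1) p ^ 2) := by
    intro p hp j h1 h2
    have h3 := hlog p hp (j + 1) (hne p hp j h1 (by omega)).2 (Real.exp (u (j + 1) p - u j p)) (by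
      have e1 := EllipticToda.vdiag_natCast (l := l) u p (c := j + 1) (by omega) h2
      have e2 := EllipticToda.vdiag_natCast (l := l) u p h1 (by omega)
      push_cast at e1 e2 ⊢
      rw [e1, add_sub_cancel_right, e2, Complex.exp_sub])
    rw [h3, add_sub_cancel_right]
  have hlogFirst : ∀ p ∈ D, Laplacian.laplacian (fun x => Real.log (G 1 x)) p
      = Real.exp (2 * u 1 p) * (1 - G 2 p * G 2 p / G 1 p ^ 2) := by
    intro p hp
    have h1 := hne p hp 1 le_rfl (by omega)
    have e0 : G 0 p = G 2 p := EllipticToda.gOf_reflect hl (by norm_num) p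
    have h3 := hlog p hp 1 (by simpa using h1.1) (Real.exp (2 * u 1 p)) (by
      have e1 := EllipticToda.vdiag_natCast (l := l) u p (c := 1) le_rfl (by omega)
      have e2 := EllipticToda.vdiag_one_sub hl u p (1 : ZMod (2 * l))
      push_cast at e1 e2 ⊢
      rw [e1] at e2 ⊢
      rw [eq_inv_of_mul_eq_one_right e2, div_inv_eq_mul, ← Complex.exp_add]
      congr 1; ring)
    rw [h3, show (1 : ℤ) - 1 = 0 by norm_num, show (1 : ℤ) + 1 = 2 by norm_num, e0]
  have hlogLast : ∀ p ∈ D, Laplacian.laplacian (fun x => Real.log (G (l + 1) x)) p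
      = Real.exp (-2 * u l p) * (1 - G l p * G l p / G (l + 1) p ^ 2) := by
    intro p hp
    have hl2 : (l : ZMod (2 * l)) + l = 0 := by
      have := ZMod.natCast_self (2 * l)
      push_cast at this
      rw [← two_mul]; exact this
    have h1 := hne p hp l (by omega) le_rfl
    have e0 : G (l + 1 + 1) p = G l p := EllipticToda.gOf_reflect hl (by
      push_cast
      linear_combination hl2) p
    have h3 := hlog p hp (l + 1) h1.2 (Real.exp (-2 * u l p)) (by
      have e1 := EllipticToda.vdiag_natCast (l := l) u p (c := l) (by omega) le_rfl
      have e2 := EllipticToda.vdiag_one_sub hl u p (l : ZMod (2 * l))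
      -- Thus v_{l+1} = v_{1−l} = e^{−u_l}, and v_{l+1}/v_l = e^{−2u_l}.
      have e3 : (l : ZMod (2 * l)) + 1 = 1 - l := by linear_combination hl2
      push_cast at e1 e2 ⊢
      rw [add_sub_cancel_right, e3]
      rw [e1] at e2 ⊢
      rw [eq_inv_of_mul_eq_one_right e2, ← Complex.exp_neg, ← Complex.exp_sub]
      congr 1; ring)
    rw [h3, add_sub_cancel_right, e0]
  refine ⟨fun j h1 h2 => (hu.1 j h1 h2).add
    (((hGs _).div (hGs _) fun p hp => (hne p hp j h1 h2).1).log
      fun p hp => (hpos p hp j h1 h2).ne'), fun p hp => ⟨?_, ?_, ?_⟩⟩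
  · have p1 := hpos p hp 1 le_rfl (by omega)
    have p2 := hpos p hp 2 (by omega) hl
    have n1 := hne p hp 1 le_rfl (by omega)
    have n2 := hne p hp 2 (by omega) hl
    have m1 := hlogMid p hp 1 le_rfl hl
    have hu1 := (hu.2 p hp).1
    have hlap1 := hlap p hp 1 le_rfl (by omega)
    simp only [Nat.cast_one, Nat.cast_ofNat, one_add_one_eq_two] at *
    rw [hlap1, EllipticToda.exp_add_log_sub p2 p1, m1, hlogFirst p hp,
      EllipticToda.exp_two_mul_add_log p1, hu1]
    obtain ⟨n1, -⟩ := n1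
    obtain ⟨n2, -⟩ := n2
    field_simp
    ring
  · intro j h1 h2
    obtain ⟨i, rfl⟩ : ∃ i, j = i + 1 := ⟨j - 1, by omega⟩
    have p0 := hpos p hp i (by omega) (by omega)
    have p1 := hpos p hp (i + 1) (by omega) (by omega)
    have p2 := hpos p hp (i + 1 + 1) (by omega) (by omega)
    have n0 := (hne p hp i (by omega) (by omega)).1
    have n1 := (hne p hp (i + 1) (by omega) (by omega)).1
    have n2 := (hne p hp (i + 1 + 1) (by omega) (by omega)).1
    have m1 := hlogMid p hp i (by omega) (by omega)
    have m2 := hlogMid p hp (i + 1) (by omega) (by omega)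
    have hu1 := (hu.2 p hp).2.1 (i + 1) h1 h2
    have hlap1 := hlap p hp (i + 1) (by omega) (by omega)
    simp only [Nat.cast_add, Nat.cast_one, add_tsub_cancel_right] at *
    rw [hlap1, EllipticToda.exp_add_log_sub p2 p1, EllipticToda.exp_add_log_sub p1 p0, m1, m2, hu1]
    field_simp
    ring
  · obtain ⟨i, rfl⟩ : ∃ i, l = i + 1 := ⟨l - 1, by omega⟩
    have p0 := hpos p hp i (by omega) (by omega)
    have p1 := hpos p hp (i + 1) (by omega) (by omega)
    have n0 := (hne p hp i (by omega) (by omega)).1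
    have n1 := hne p hp (i + 1) (by omega) (by omega)
    have m1 := hlogMid p hp i (by omega) (by omega)
    have m2 := hlogLast p hp
    have hu1 := (hu.2 p hp).2.2
    have hlap1 := hlap p hp (i + 1) (by omega) (by omega)
    simp only [Nat.cast_add, Nat.cast_one, add_tsub_cancel_right] at *
    rw [hlap1, EllipticToda.exp_add_log_sub p1 p0, EllipticToda.exp_neg_two_mul_add_log p1, m1, m2,
      hu1]
    obtain ⟨n1, n2⟩ := n1
    field_simp
    ring
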